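/- Theorem (Representer theorem for the robust C-margin problem). Let $X$ be a real Banach space with dual $X^*$ and write $\langle x,w\rangle=w(x)$ for $x\in X$, $w\in X^*$. Let $y_1,\dots,y_m\in\{-1,1\}$ be labels such that $I_+=\{i: y_i=1\}$ and $I_-=\{i: y_i=-1\}$ are both nonempty, let $K_1,\dots,K_m\subset X$ be nonempty sets, put $K=\prod_{i=1}^m K_i$, and let $K_\pm$ be the convex hull of $\bigcup_{i\in I_\pm}K_i$. Let $M(x)=\{x^*\in X^*:\langle x,x^*\rangle=\|x\|^2=\|x^*\|^2\}$ be the normalized duality mapping. Consider the problem $$\text{(R-CM)}\qquad \min_{(w,\alpha,\beta)\in X^*\times\mathbb R\times\mathbb R}\ \tfrac12\|w\|^2-(\alpha-\beta)\quad\text{s.t.}\quad \min_{x_i\in K_i}\langle x_i,w\rangle\ge\alpha\ (i\in I_+),\quad \max_{x_i\in K_i}\langle x_i,w\rangle\le\beta\ (i\in I_-).$$ If the sets $K_i$, $i=1,\dots,m$, are convex and weakly compact and $K_+\cap K_-=\emptyset$, then (R-CM) admits at least one solution. Moreover, $(\bar w,\bar\alpha,\bar\beta)\in X^*\times\mathbb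 R\times\mathbb R$ is a minimizer of (R-CM) if and only if there exist $\bar\lambda\in\mathbb R^m$ with $\bar\lambda_i\ge 0$ for all $i$ and $\bar x\in K$ such that $$\max_{x_i\in K_i}(\bar\alpha-\langle x_i,\bar w\rangle)\le 0\ \ (i\in I_+),\qquad \max_{x_i\in K_i}(\langle x_i,\bar w\rangle-\bar\beta)\le 0\ \ (i\in I_-),$$ $$\bar w\in M\Big(\sum_{i=1}^m y_i\bar\lambda_i\bar x_i\Big),\qquad \sum_{i\in I_+}\bar\lambda_i=\sum_{i\in I_-}\bar\lambda_i=1,$$ $$\bar\lambda_i(\bar\alpha-\langle\bar x_i,\bar w\rangle)=0\ \ (i\in I_+),\qquad \bar\lambda_i(\bar\beta-\langle\bar x_i,\bar w\rangle)=0\ \ (i\in I_-).$$ -/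

import Mathlib

namespace RobustCM

noncomputable section

/-- A set of a real normed space is weakly compact: compact for the weak topology. -/
def WeaklyCompact {X : Type*} [NormedAddCommGroup X] [NormedSpace ℝ X] (S : Set X) : Prop :=
  IsCompact (toWeakSpace ℝ X '' S)

/-- The normalized duality mapping `M : X → 2^{X*}`. -/
def dualityMap {X : Type*} [NormedAddCommGroup X] [NormedSpace ℝ X] (x : X) :
    Set (StrongDual ℝ X) :=
  {f | f x = ‖x‖ ^ 2 ∧ ‖x‖ ^ 2 = ‖f‖ ^ 2}

/-- The index set `I₊` of the class labelled `+1`. -/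
def posIdx {m : ℕ} (y : Fin m → ℝ) : Finset (Fin m) := {i | y i = 1}

/-- The index set `I₋` of the class labelled `-1`. -/
def negIdx {m : ℕ} (y : Fin m → ℝ) : Finset (Fin m) := {i | y i = -1}

/-- The convex hull of the union of the uncertainty sets with index in `J`
(`K₊` for `J = I₊`, `K₋` for `J = I₋`). -/
def classHull {X : Type*} [NormedAddCommGroup X] [NormedSpace ℝ X] {m : ℕ}
    (K : Fin m → Set X) (J : Finset (Fin m)) : Set X :=
  convexHull ℝ (⋃ i ∈ J, K i)

/-- The feasible set of (R-CM): triples `(w, α, β)` with `min_{x ∈ K i} ⟨x, w⟩ ≥ α` for `i ∈ I₊`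
and `max_{x ∈ K i} ⟨x, w⟩ ≤ β` for `i ∈ I₋`. -/
def feasibleSet {X : Type*} [NormedAddCommGroup X] [NormedSpace ℝ X] {m : ℕ}
    (y : Fin m → ℝ) (K : Fin m → Set X) : Set (StrongDual ℝ X × ℝ × ℝ) :=
  {p | (∀ i ∈ posIdx y, ∃ μ, IsLeast ((fun x => p.1 x) '' K i) μ ∧ p.2.1 ≤ μ) ∧
       (∀ i ∈ negIdx y, ∃ μ, IsGreatest ((fun x => p.1 x) '' K i) μ ∧ μ ≤ p.2.2)}

/-- The objective `½‖w‖² - (α - β)` of (R-CM). -/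
def objective {X : Type*} [NormedAddCommGroup X] [NormedSpace ℝ X]
    (p : StrongDual ℝ X × ℝ × ℝ) : ℝ :=
  1 / 2 * ‖p.1‖ ^ 2 - (p.2.1 - p.2.2)

/-- `(w, α, β)` is a (global) minimizer of (R-CM). -/
def IsMinimizer {X : Type*} [NormedAddCommGroup X] [NormedSpace ℝ X] {m : ℕ}
    (y : Fin m → ℝ) (K : Fin m → Set X) (w : StrongDual ℝ X) (α β : ℝ) : Prop :=
  (w, α, β) ∈ feasibleSet y K ∧ IsMinOn objective (feasibleSet y K) (w, α, β)

end

end RobustCM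

namespace RobustCM

open Set Metric
open scoped Pointwise

section Weak

variable {X : Type*} [NormedAddCommGroup X] [NormedSpace ℝ X]

/-! The dual problem is to minimise the norm over `signedSums y K`, that is, over K₊ - K₋. If (w, α,
β) is feasible and v is a signed sum, then α - β ≤ w v ≤ ‖w‖‖v‖, so the objective is at least
-½‖v‖². The signed sums form a convex weakly compact set, hence contain a point v of least norm.
Separating them from the open ball of radius ‖v‖ yields w ∈ M(v) that attains the bound. Optimality
therefore means equality throughout: ‖w‖ = ‖v‖, w v = ‖v‖² and w v = α - β. The last is
complementary slackness, since w v - (α - β) is a sum of nonnegative weighted slacks. -/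

theorem lowerSemicontinuous_norm_weakSpace :
    LowerSemicontinuous fun z : WeakSpace ℝ X => ‖(toWeakSpace ℝ X).symm z‖ := by
  rw [lowerSemicontinuous_iff_isClosed_preimage]
  intro r
  -- Mazur: norm-closed balls, being convex, are weakly closed.
  have h := (convex_closedBall (0 : X) r).toWeakSpace_closure ℝ
  rw [isClosed_closedBall.closure_eq] at h
  have h' : IsClosed (toWeakSpace ℝ X '' closedBall (0 : X) r) := by
    rw [h]; exact isClosed_closure
  convert h' using 1
  ext z
  rw [LinearEquiv.image_eq_preimage_symm]
  simp

theorem continuous_dual_weakSpace (f : StrongDual ℝ X) :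
    Continuous fun z : WeakSpace ℝ X => f ((toWeakSpace ℝ X).symm z) :=
  WeakBilin.eval_continuous (topDualPairing ℝ X).flip f

theorem WeaklyCompact.isCompact_image {S : Set X} (hS : WeaklyCompact S)
    (f : StrongDual ℝ X) : IsCompact (f '' S) := by
  have h := IsCompact.image hS (continuous_dual_weakSpace f)
  rwa [image_image] at h

/-- A nonempty weakly compact set contains a point of minimal norm. -/
theorem WeaklyCompact.exists_norm_le {S : Set X} (hS : WeaklyCompact S) (hne : S.Nonempty) :
    ∃ v ∈ S, ∀ z ∈ S, ‖v‖ ≤ ‖z‖ := by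
  obtain ⟨_, ⟨v, hv, rfl⟩, hmin⟩ := LowerSemicontinuousOn.exists_isMinOn
    (hne.image (toWeakSpace ℝ X)) hS (lowerSemicontinuous_norm_weakSpace.lowerSemicontinuousOn _)
  refine ⟨v, hv, fun z hz => ?_⟩
  simpa using hmin (mem_image_of_mem _ hz)

theorem apply_le_norm_mul_norm (w : StrongDual ℝ X) (v : X) : w v ≤ ‖w‖ * ‖v‖ :=
  (le_abs_self _).trans (w.le_opNorm v)

/-- At a point `v` of minimal norm of a convex set `D`, some element of the duality map at `v`
supports `D`. -/
theorem exists_mem_dualityMap_of_norm_le {D : Set X} (hD : Convex ℝ D) {v : X} (hv : v ∈ D)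
    (hmin : ∀ z ∈ D, ‖v‖ ≤ ‖z‖) :
    ∃ w ∈ dualityMap v, ∀ z ∈ D, ‖v‖ ^ 2 ≤ w z := by
  rcases eq_or_ne v 0 with rfl | hv0
  · exact ⟨0, by simp [dualityMap], by simp⟩
  have hd : 0 < ‖v‖ := norm_pos_iff.2 hv0
  have hdisj : Disjoint (ball (0 : X) ‖v‖) D := by
    rw [Set.disjoint_left]
    intro z hz hzD
    exact absurd (hmin z hzD) (not_le.2 (by simpa using hz))
  obtain ⟨f, u, hf, hu⟩ := geometric_hahn_banach_open (convex_ball _ _) isOpen_ball hD hdisj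
  have hu0 : 0 < u := by simpa using hf 0 (by simpa using hd)
  -- Rescaling moves the separating level from u to ‖v‖².
  have hc : 0 < ‖v‖ ^ 2 / u := by positivity
  set w : StrongDual ℝ X := (‖v‖ ^ 2 / u) • f with hw
  have hball : ∀ z : X, ‖z‖ < ‖v‖ → w z ≤ ‖v‖ ^ 2 := by
    intro z hz
    have h1 := mul_le_mul_of_nonneg_left (hf z (by simpa using hz)).le hc.le
    rwa [div_mul_cancel₀ _ hu0.ne'] at h1
  have hwD : ∀ z ∈ D, ‖v‖ ^ 2 ≤ w z := by
    intro z hz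
    have h1 := mul_le_mul_of_nonneg_left (hu z hz) hc.le
    rwa [div_mul_cancel₀ _ hu0.ne'] at h1
  -- Symmetry of the ball bounds |w|, and closure reaches the boundary; this gives ‖w‖ ≤ ‖v‖.
  have habs : ∀ z ∈ closedBall (0 : X) ‖v‖, ‖w z‖ ≤ ‖v‖ ^ 2 := by
    rw [← closure_ball _ hd.ne']
    refine fun z hz => closure_minimal (t := {z | ‖w z‖ ≤ ‖v‖ ^ 2}) ?_ ?_ hz
    · intro z hz
      have hz' : ‖z‖ < ‖v‖ := by simpa using hz
      have h1 := hball z hz'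
      have h2 := hball (-z) (by simpa using hz')
      rw [map_neg] at h2
      exact abs_le.2 ⟨by linarith, h1⟩
    · exact isClosed_le (by fun_prop) continuous_const
  have hnorm : ‖w‖ ≤ ‖v‖ := by
    have h := w.opNorm_bound_of_ball_bound hd _ habs
    rwa [pow_two, mul_div_assoc, div_self hd.ne', mul_one] at h
  have h1 := hwD v hv
  have h2 := apply_le_norm_mul_norm w v
  have hnorm' : ‖w‖ = ‖v‖ := le_antisymm hnorm (by nlinarith)
  refine ⟨w, ⟨?_, by rw [hnorm']⟩, hwD⟩
  rw [hnorm'] at h2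
  nlinarith

end Weak

section Weights

variable {m : ℕ} {y : Fin m → ℝ}

/-- Weights that are nonnegative and sum to one on each of the two classes. -/
def classWeights (y : Fin m → ℝ) : Set (Fin m → ℝ) :=
  {l | (∀ i, 0 ≤ l i) ∧ ∑ i ∈ posIdx y, l i = 1 ∧ ∑ i ∈ negIdx y, l i = 1}

theorem mem_posIdx {i : Fin m} : i ∈ posIdx y ↔ y i = 1 := by simp [posIdx]

theorem mem_negIdx {i : Fin m} : i ∈ negIdx y ↔ y i = -1 := by simp [negIdx]

theorem disjoint_posIdx_negIdx : Disjoint (posIdx y) (negIdx y) := by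
  rw [Finset.disjoint_left]
  intro i h1 h2
  rw [mem_posIdx] at h1
  rw [mem_negIdx] at h2
  linarith

theorem sum_eq_posIdx_add_negIdx (hy : ∀ i, y i = 1 ∨ y i = -1) (g : Fin m → ℝ) :
    ∑ i, g i = ∑ i ∈ posIdx y, g i + ∑ i ∈ negIdx y, g i := by
  rw [← Finset.sum_union disjoint_posIdx_negIdx]
  refine Finset.sum_congr ?_ fun _ _ => rfl
  ext i
  simpa [mem_posIdx, mem_negIdx] using hy i

theorem single_add_single_mem_classWeights {i j : Fin m} (hi : i ∈ posIdx y)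
    (hj : j ∈ negIdx y) :
    (Pi.single i 1 + Pi.single j 1 : Fin m → ℝ) ∈ classWeights y := by
  have hi' : i ∉ negIdx y := Finset.disjoint_left.1 disjoint_posIdx_negIdx hi
  have hj' : j ∉ posIdx y := Finset.disjoint_right.1 disjoint_posIdx_negIdx hj
  refine ⟨fun k => ?_, ?_, ?_⟩
  · have h1 : (0 : Fin m → ℝ) ≤ Pi.single i 1 := Pi.single_nonneg.2 zero_le_one
    have h2 : (0 : Fin m → ℝ) ≤ Pi.single j 1 := Pi.single_nonneg.2 zero_le_one
    exact add_nonneg (h1 k) (h2 k)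
  · simp [Finset.sum_add_distrib, hi, hj']
  · simp [Finset.sum_add_distrib, hi', hj]

theorem isCompact_classWeights (hy : ∀ i, y i = 1 ∨ y i = -1) :
    IsCompact (classWeights y) := by
  refine IsCompact.of_isClosed_subset
    (isCompact_univ_pi fun _ : Fin m => isCompact_Icc (a := (0 : ℝ)) (b := 1)) ?_ ?_
  · have h1 : IsClosed {l : Fin m → ℝ | ∀ i, 0 ≤ l i} := by
      simp only [ofPred_forall]
      exact isClosed_iInter fun i => isClosed_le continuous_const (continuous_apply i)
    have h2 (J : Finset (Fin m)) : IsClosed {l : Fin m → ℝ | ∑ i ∈ J, l i = 1} :=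
      isClosed_eq (by fun_prop) continuous_const
    exact h1.inter ((h2 _).inter (h2 _))
  · rintro l ⟨h0, hp, hn⟩ i -
    refine ⟨h0 i, ?_⟩
    rcases hy i with h | h
    · exact hp ▸ Finset.single_le_sum (fun k _ => h0 k) (mem_posIdx.2 h)
    · exact hn ▸ Finset.single_le_sum (fun k _ => h0 k) (mem_negIdx.2 h)

end Weights

section SignedSums

variable {X : Type*} [NormedAddCommGroup X] [NormedSpace ℝ X] {m : ℕ} {y : Fin m → ℝ}
  {K : Fin m → Set X}

/-- The differences `K₊ - K₋`, written as signed combinations of points of the `K i`. -/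
def signedSums (y : Fin m → ℝ) (K : Fin m → Set X) : Set X :=
  (fun p : (Fin m → ℝ) × (Fin m → X) => ∑ i, (y i * p.1 i) • p.2 i) ''
    (classWeights y ×ˢ Set.univ.pi K)

/-- A jointly continuous image of a product of compact sets, each K i carrying the weak topology. -/
theorem weaklyCompact_signedSums (hy : ∀ i, y i = 1 ∨ y i = -1)
    (hcomp : ∀ i, WeaklyCompact (K i)) : WeaklyCompact (signedSums y K) := by
  have hP := (isCompact_classWeights hy).prod (isCompact_univ_pi hcomp)
  have hcont : Continuous fun p : (Fin m → ℝ) × (Fin m → WeakSpace ℝ X) =>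
      ∑ i, (y i * p.1 i) • p.2 i := by fun_prop
  have h := hP.image hcont
  unfold WeaklyCompact
  convert h using 1
  ext z
  constructor
  · rintro ⟨_, ⟨⟨l, x⟩, ⟨hl, hx⟩, rfl⟩, rfl⟩
    refine ⟨(l, fun i => toWeakSpace ℝ X (x i)),
      ⟨hl, fun i _ => mem_image_of_mem _ (hx i trivial)⟩, ?_⟩
    simp
  · rintro ⟨⟨l, x⟩, ⟨hl, hx⟩, rfl⟩
    choose x' hx' hxx' using fun i => hx i trivial
    refine ⟨_, ⟨(l, x'), ⟨hl, fun i _ => hx' i⟩, rfl⟩, ?_⟩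
    simp [hxx']

/-- The parametrisation is bilinear, so the weights are averaged and each point is replaced by a
reweighted average, using sK + tK = (s + t)K for convex K and s, t ≥ 0. -/
theorem convex_signedSums (hconv : ∀ i, Convex ℝ (K i)) : Convex ℝ (signedSums y K) := by
  rintro _ ⟨⟨l, x⟩, ⟨⟨hl0, hlp, hln⟩, hx⟩, rfl⟩ _ ⟨⟨l', x'⟩, ⟨⟨hl0', hlp', hln'⟩, hx'⟩, rfl⟩
    a b ha hb hab
  have key : ∀ i, ∃ u ∈ K i,
      (a * l i + b * l' i) • u = (a * l i) • x i + (b * l' i) • x' i := by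
    intro i
    have h : (a * l i) • x i + (b * l' i) • x' i ∈ (a * l i + b * l' i) • K i := by
      rw [(hconv i).add_smul (mul_nonneg ha (hl0 i)) (mul_nonneg hb (hl0' i))]
      exact Set.add_mem_add (Set.smul_mem_smul_set (hx i trivial))
        (Set.smul_mem_smul_set (hx' i trivial))
    exact h
  choose u hu hsum using key
  refine ⟨(fun i => a * l i + b * l' i, u), ⟨⟨fun i => ?_, ?_, ?_⟩, fun i _ => hu i⟩, ?_⟩
  · exact add_nonneg (mul_nonneg ha (hl0 i)) (mul_nonneg hb (hl0' i))
  · simp only [Finset.sum_add_distrib, ← Finset.mul_sum, hlp, hlp', mul_one, hab]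
  · simp only [Finset.sum_add_distrib, ← Finset.mul_sum, hln, hln', mul_one, hab]
  · simp only [Finset.smul_sum, ← Finset.sum_add_distrib]
    refine Finset.sum_congr rfl fun i _ => ?_
    rw [mul_smul, hsum, smul_add]
    simp only [smul_smul]
    congr 2 <;> ring

theorem sub_mem_signedSums (hne : ∀ i, (K i).Nonempty) {i j : Fin m} (hi : i ∈ posIdx y)
    (hj : j ∈ negIdx y) {x z : X} (hx : x ∈ K i) (hz : z ∈ K j) : x - z ∈ signedSums y K := by
  choose c hc using hne
  have hij : i ≠ j := fun h =>
    Finset.disjoint_left.1 disjoint_posIdx_negIdx hi (h ▸ hj)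
  -- The points `c k` are fillers carrying weight zero.
  refine ⟨(Pi.single i 1 + Pi.single j 1, Function.update (Function.update c i x) j z),
    ⟨single_add_single_mem_classWeights hi hj, fun k _ => ?_⟩, ?_⟩
  · by_cases hkj : k = j
    · subst hkj; simpa using hz
    by_cases hki : k = i
    · subst hki; simpa [hkj] using hx
    simpa [hkj, hki] using hc k
  · simp only [Pi.add_apply, mul_add, add_smul, Finset.sum_add_distrib]
    rw [Finset.sum_eq_single i (fun k _ hk => by simp [hk]) (by simp),
      Finset.sum_eq_single j (fun k _ hk => by simp [hk]) (by simp)]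
    simp [hij, mem_posIdx.1 hi, mem_negIdx.1 hj, sub_eq_add_neg]

end SignedSums

section Feasible

variable {X : Type*} [NormedAddCommGroup X] [NormedSpace ℝ X] {m : ℕ} {y : Fin m → ℝ}
  {K : Fin m → Set X} {w : StrongDual ℝ X} {α β : ℝ}

theorem mem_feasibleSet_iff (hne : ∀ i, (K i).Nonempty) (hcomp : ∀ i, WeaklyCompact (K i)) :
    (w, α, β) ∈ feasibleSet y K ↔
      (∀ i ∈ posIdx y, ∀ z ∈ K i, α ≤ w z) ∧ (∀ i ∈ negIdx y, ∀ z ∈ K i, w z ≤ β) := by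
  refine and_congr (forall₂_congr fun i _ => ?_) (forall₂_congr fun i _ => ?_)
  · constructor
    · rintro ⟨μ, hμ, hle⟩ z hz
      exact le_trans hle (hμ.2 (mem_image_of_mem _ hz))
    · intro h
      obtain ⟨μ, hμ⟩ := ((hcomp i).isCompact_image w).exists_isLeast ((hne i).image _)
      refine ⟨μ, hμ, ?_⟩
      obtain ⟨z, hz, rfl⟩ := hμ.1
      exact h z hz
  · constructor
    · rintro ⟨μ, hμ, hle⟩ z hz
      exact le_trans (hμ.2 (mem_image_of_mem _ hz)) hle
    · intro h
      obtain ⟨μ, hμ⟩ := ((hcomp i).isCompact_image w).exists_isGreatest ((hne i).image _)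
      refine ⟨μ, hμ, ?_⟩
      obtain ⟨z, hz, rfl⟩ := hμ.1
      exact h z hz

theorem forall_le_iff_exists_isGreatest {S : Set X} (hS : WeaklyCompact S) (hne : S.Nonempty)
    (f : StrongDual ℝ X) (c : ℝ) :
    (∀ z ∈ S, f z ≤ c) ↔ ∃ μ, IsGreatest ((fun z => f z - c) '' S) μ ∧ μ ≤ 0 := by
  constructor
  · intro h
    obtain ⟨_, ⟨z, hz, rfl⟩, hub⟩ := (hS.isCompact_image f).exists_isGreatest (hne.image _)
    refine ⟨f z - c, ⟨mem_image_of_mem _ hz, ?_⟩, sub_nonpos.2 (h z hz)⟩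
    rintro _ ⟨z', hz', rfl⟩
    exact sub_le_sub_right (hub (mem_image_of_mem _ hz')) c
  · rintro ⟨μ, hμ, hle⟩ z hz
    exact sub_nonpos.1 (le_trans (hμ.2 (mem_image_of_mem _ hz)) hle)

theorem mem_feasibleSet_iff_isGreatest (hne : ∀ i, (K i).Nonempty)
    (hcomp : ∀ i, WeaklyCompact (K i)) :
    (w, α, β) ∈ feasibleSet y K ↔
      (∀ i ∈ posIdx y, ∃ μ, IsGreatest ((fun z => α - w z) '' K i) μ ∧ μ ≤ 0) ∧
      (∀ i ∈ negIdx y, ∃ μ, IsGreatest ((fun z => w z - β) '' K i) μ ∧ μ ≤ 0) := by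
  rw [mem_feasibleSet_iff hne hcomp]
  refine and_congr (forall₂_congr fun i _ => ?_)
    (forall₂_congr fun i _ => forall_le_iff_exists_isGreatest (hcomp i) (hne i) w β)
  have h := forall_le_iff_exists_isGreatest (hcomp i) (hne i) (-w) (-α)
  have h1 (z : X) : -w z - -α = α - w z := by ring
  simpa only [neg_apply, neg_le_neg_iff, h1] using h

/-- The slack of the margin at a signed combination, as the sum of the constraint slacks. -/
theorem apply_signedSum_sub (hy : ∀ i, y i = 1 ∨ y i = -1) {l : Fin m → ℝ}
    (hl : l ∈ classWeights y) (x : Fin m → X) :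
    w (∑ i, (y i * l i) • x i) - (α - β) =
      ∑ i ∈ posIdx y, l i * (w (x i) - α) + ∑ i ∈ negIdx y, l i * (β - w (x i)) := by
  obtain ⟨-, hp, hn⟩ := hl
  rw [map_sum, sum_eq_posIdx_add_negIdx hy]
  have h1 : ∑ i ∈ posIdx y, w ((y i * l i) • x i) = ∑ i ∈ posIdx y, l i * w (x i) :=
    Finset.sum_congr rfl fun i hi => by simp [mem_posIdx.1 hi]
  have h2 : ∑ i ∈ negIdx y, w ((y i * l i) • x i) = -∑ i ∈ negIdx y, l i * w (x i) := by
    rw [← Finset.sum_neg_distrib]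
    exact Finset.sum_congr rfl fun i hi => by simp [mem_negIdx.1 hi]
  rw [h1, h2]
  simp only [mul_sub, Finset.sum_sub_distrib, ← Finset.sum_mul, hp, hn]
  ring

theorem margin_le_apply_signedSum (hy : ∀ i, y i = 1 ∨ y i = -1)
    (hp : ∀ i ∈ posIdx y, ∀ z ∈ K i, α ≤ w z) (hn : ∀ i ∈ negIdx y, ∀ z ∈ K i, w z ≤ β)
    {v : X} (hv : v ∈ signedSums y K) : α - β ≤ w v := by
  obtain ⟨⟨l, x⟩, ⟨hl, hx⟩, rfl⟩ := hv
  have h := apply_signedSum_sub (w := w) (α := α) (β := β) hy hl x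
  have h1 : 0 ≤ ∑ i ∈ posIdx y, l i * (w (x i) - α) := Finset.sum_nonneg fun i hi =>
    mul_nonneg (hl.1 i) (sub_nonneg.2 (hp i hi _ (hx i trivial)))
  have h2 : 0 ≤ ∑ i ∈ negIdx y, l i * (β - w (x i)) := Finset.sum_nonneg fun i hi =>
    mul_nonneg (hl.1 i) (sub_nonneg.2 (hn i hi _ (hx i trivial)))
  dsimp only
  linarith

/-- Weak duality: signed combinations bound the objective from below. -/
theorem neg_half_sq_norm_le_objective (hy : ∀ i, y i = 1 ∨ y i = -1)
    (hne : ∀ i, (K i).Nonempty) (hcomp : ∀ i, WeaklyCompact (K i)) {v : X}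
    (hv : v ∈ signedSums y K) {p : StrongDual ℝ X × ℝ × ℝ} (hp : p ∈ feasibleSet y K) :
    -(1 / 2 * ‖v‖ ^ 2) ≤ objective p := by
  obtain ⟨w, α, β⟩ := p
  obtain ⟨h1, h2⟩ := (mem_feasibleSet_iff hne hcomp).1 hp
  have h3 := margin_le_apply_signedSum hy h1 h2 hv
  have h4 := apply_le_norm_mul_norm w v
  simp only [objective]
  -- ½‖w‖² - ‖w‖‖v‖ + ½‖v‖² is half a square.
  nlinarith [sq_nonneg (‖w‖ - ‖v‖)]

/-- Strong duality: the lower bound given by a signed combination of minimal norm is attained. -/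
theorem exists_feasible_objective_le (hpos : (posIdx y).Nonempty) (hneg : (negIdx y).Nonempty)
    (hne : ∀ i, (K i).Nonempty) (hconv : ∀ i, Convex ℝ (K i))
    (hcomp : ∀ i, WeaklyCompact (K i)) {v : X} (hv : v ∈ signedSums y K)
    (hmin : ∀ z ∈ signedSums y K, ‖v‖ ≤ ‖z‖) :
    ∃ (w : StrongDual ℝ X) (α β : ℝ), (w, α, β) ∈ feasibleSet y K ∧
      objective (w, α, β) ≤ -(1 / 2 * ‖v‖ ^ 2) := by
  obtain ⟨w, ⟨-, hwv⟩, hw⟩ :=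
    exists_mem_dualityMap_of_norm_le (convex_signedSums hconv) hv hmin
  choose a ha using fun i =>
    ((hcomp i).isCompact_image w).exists_isLeast ((hne i).image _)
  choose b hb using fun i =>
    ((hcomp i).isCompact_image w).exists_isGreatest ((hne i).image _)
  obtain ⟨i, hi, hia⟩ := (posIdx y).exists_min_image a hpos
  obtain ⟨j, hj, hjb⟩ := (negIdx y).exists_max_image b hneg
  -- The largest α and the smallest β feasible for this w; both are attained, so α - β is the value
  -- of w at a signed sum.
  refine ⟨w, a i, b j, ⟨fun k hk => ⟨a k, ha k, hia k hk⟩, fun k hk => ⟨b k, hb k, hjb k hk⟩⟩, ?_⟩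
  obtain ⟨x, hx, hxa⟩ := (ha i).1
  obtain ⟨z, hz, hzb⟩ := (hb j).1
  have h := hw _ (sub_mem_signedSums hne hi hj hx hz)
  rw [map_sub, hxa, hzb] at h
  simp only [objective, ← hwv]
  linarith

end Feasible

end RobustCM

open RobustCM Set in
/-- Representer theorem for the robust C-margin problem. Disjointness of the class hulls is not
needed: if they meet, the least-norm signed combination is `0` and the optimal value is `0`. -/
theorem mainTheorem7 {X : Type*} [NormedAddCommGroup X] [NormedSpace ℝ X] [CompleteSpace X]
    {m : ℕ} (y : Fin m → ℝ) (K : Fin m → Set X)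
    (hy : ∀ i, y i = 1 ∨ y i = -1)
    (hpos : (RobustCM.posIdx y).Nonempty) (hneg : (RobustCM.negIdx y).Nonempty)
    (hne : ∀ i, (K i).Nonempty)
    (hconv : ∀ i, Convex ℝ (K i))
    (hcomp : ∀ i, RobustCM.WeaklyCompact (K i))
    (hdisj : RobustCM.classHull K (RobustCM.posIdx y) ∩
      RobustCM.classHull K (RobustCM.negIdx y) = ∅) :
    (∃ (w : StrongDual ℝ X) (α β : ℝ), RobustCM.IsMinimizer y K w α β) ∧
    ∀ (w : StrongDual ℝ X) (α β : ℝ),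
      RobustCM.IsMinimizer y K w α β ↔
        ∃ (l : Fin m → ℝ) (x : Fin m → X),
          (∀ i, 0 ≤ l i) ∧ x ∈ Set.univ.pi K ∧
          (∀ i ∈ RobustCM.posIdx y,
            ∃ μ, IsGreatest ((fun z => α - w z) '' K i) μ ∧ μ ≤ 0) ∧
          (∀ i ∈ RobustCM.negIdx y,
            ∃ μ, IsGreatest ((fun z => w z - β) '' K i) μ ∧ μ ≤ 0) ∧
          w ∈ RobustCM.dualityMap (∑ i, (y i * l i) • x i) ∧
          (∑ i ∈ RobustCM.posIdx y, l i = 1) ∧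
          (∑ i ∈ RobustCM.negIdx y, l i = 1) ∧
          (∀ i ∈ RobustCM.posIdx y, l i * (α - w (x i)) = 0) ∧
          (∀ i ∈ RobustCM.negIdx y, l i * (β - w (x i)) = 0) := by
  obtain ⟨i, hi⟩ := hpos
  obtain ⟨j, hj⟩ := hneg
  have hDne : (signedSums y K).Nonempty :=
    ⟨_, sub_mem_signedSums hne hi hj (hne i).some_mem (hne j).some_mem⟩
  obtain ⟨v, hv, hmin⟩ := (weaklyCompact_signedSums hy hcomp).exists_norm_le hDne
  obtain ⟨w₀, α₀, β₀, hfeas₀, hobj₀⟩ :=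
    exists_feasible_objective_le ⟨i, hi⟩ ⟨j, hj⟩ hne hconv hcomp hv hmin
  refine ⟨⟨w₀, α₀, β₀, hfeas₀, fun p hp =>
    hobj₀.trans (neg_half_sq_norm_le_objective hy hne hcomp hv hp)⟩, fun w α β => ⟨?_, ?_⟩⟩
  · rintro ⟨hfeas, hopt⟩
    have hobj := (hopt hfeas₀).trans hobj₀
    obtain ⟨hg₁, hg₂⟩ := (mem_feasibleSet_iff_isGreatest hne hcomp).1 hfeas
    obtain ⟨hp, hn⟩ := (mem_feasibleSet_iff hne hcomp).1 hfeas
    have hmargin := margin_le_apply_signedSum hy hp hn hv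
    have hle := apply_le_norm_mul_norm w v
    simp only [objective] at hobj
    have hnorm : ‖w‖ = ‖v‖ := by
      have : (‖w‖ - ‖v‖) ^ 2 ≤ 0 := by nlinarith
      exact sub_eq_zero.1 (pow_eq_zero_iff two_ne_zero |>.1 (le_antisymm this (sq_nonneg _)))
    rw [hnorm] at hobj hle
    have hwv : w v = ‖v‖ ^ 2 := by nlinarith
    have hgap : w v - (α - β) = 0 := by nlinarith
    obtain ⟨⟨l, x⟩, ⟨hl, hx⟩, rfl⟩ := hv
    have hslack := apply_signedSum_sub (w := w) (α := α) (β := β) hy hl x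
    have h1 : ∀ i ∈ posIdx y, 0 ≤ l i * (w (x i) - α) := fun i hi =>
      mul_nonneg (hl.1 i) (sub_nonneg.2 (hp i hi _ (hx i trivial)))
    have h2 : ∀ i ∈ negIdx y, 0 ≤ l i * (β - w (x i)) := fun i hi =>
      mul_nonneg (hl.1 i) (sub_nonneg.2 (hn i hi _ (hx i trivial)))
    have hs1 := Finset.sum_nonneg h1
    have hs2 := Finset.sum_nonneg h2
    rw [hgap] at hslack
    have hz1 := (Finset.sum_eq_zero_iff_of_nonneg h1).1 (by linarith)
    have hz2 := (Finset.sum_eq_zero_iff_of_nonneg h2).1 (by linarith)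
    refine ⟨l, x, hl.1, hx, hg₁, hg₂, ⟨hwv, by rw [hnorm]⟩, hl.2.1, hl.2.2,
      fun k hk => ?_, hz2⟩
    linear_combination -hz1 k hk
  · rintro ⟨l, x, hl, hx, hg₁, hg₂, ⟨hw₁, hw₂⟩, hsp, hsn, hc₁, hc₂⟩
    have hfeas := (mem_feasibleSet_iff_isGreatest hne hcomp).2 ⟨hg₁, hg₂⟩
    have hlw : l ∈ classWeights y := ⟨hl, hsp, hsn⟩
    have hslack := apply_signedSum_sub (w := w) (α := α) (β := β) hy hlw x
    have hc₁' : ∀ k ∈ posIdx y, l k * (w (x k) - α) = 0 := fun k hk => by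
      linear_combination -hc₁ k hk
    rw [Finset.sum_eq_zero hc₁', Finset.sum_eq_zero hc₂, hw₁] at hslack
    refine ⟨hfeas, fun p hp => ?_⟩
    -- Weak duality at the given signed sum suffices: its norm need not be known to be minimal.
    refine le_trans ?_ (neg_half_sq_norm_le_objective hy hne hcomp
      ⟨(l, x), ⟨hlw, hx⟩, rfl⟩ hp)
    simp only [objective]
    linarith
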